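/- Let $\mathcal I_n$ be the set of inversion sequences of length $n$, i.e. integer sequences $(\sigma_1,\dots,\sigma_n)$ with $0\le\sigma_i\le i-1$. For $n,m\ge 0$ let $\mathcal A_{n,m}$ be the set of $\sigma\in\mathcal I_n$ together with a colouring of the values $0,\dots,n-1$ (whether or not they occur in $\sigma$) by blue and red, with $m$ blue values and $n-m$ red values, such that every red value occurs at least twice in $\sigma$. For $n,m\ge 1$ let $\mathcal B_{n,m}$ be the set of rooted non-plane trees on $n$ nodes, labelled bijectively by $0,\dots,n-1$ so that each non-root node has a greater label than its parent, with $m$ nodes coloured blue and $n-m$ coloured red, such that every red node has at least two children. (Both sets are empty if $n<m$.) Let $$B(x,y)=\sum_{n,m\ge1}\frac{|\mathcal B_{n,m}|}{n!}\,x^ny^m .$$ 1. As formal power series, $$\frac{\partial B}{\partial x}(x,y)=(y+1)e^{B(x,y)}-B(x,y)-1,\qquad B(0,y)=0 .$$ 2. For $\sigma\in\mathcal A_{n,m}$ let $\phi(\sigma)$ be the coloured tree with nodes $0,\dots,n$ and root $0$ in which the children of node $v$ are the positions (in $\{1,\dots,n\}$) of the value $v$ in $\sigma$, each node $v<n$ has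 the colour of the value $v$, and node $n$ is blue. Then, for all $n,m\ge 0$, $\phi$ is a bijection from $\mathcal A_{n,m}$ onto $\mathcal B_{n+1,m+1}$. 3. A Cayley permutation is a finite sequence whose set of values is $\{0,\dots,M\}$ for some $M$ (or empty); a sequence contains $\rho$ if it has a subsequence order-isomorphic to $\rho$. For a nonempty Cayley permutation $\rho$, a $\rho$-minimal inversion sequence is a minimal element, for pattern containment, of the set of all inversion sequences (of any length) that are Cayley permutations and contain $\rho$. Let $\rho=(\rho_1,\dots,\rho_k)$, $k\ge1$, be a Cayley permutation with $\rho_1=\mathbf{mdd}(\rho)=m$, where $\mathbf{mdd}(\rho)=\max_{1\le i\le k}(\rho_i-i+1)$. Then, for every $n\ge0$, the number of $\rho$-minimal inversion sequences of length $n+k$ is $$|\mathcal A_{n,m}|=|\mathcal B_{n+1,m+1}|=(n+1)!\,[x^{n+1}y^{m+1}]B(x,y),$$ and there are finitely many $\rho$-minimal inversion sequences in total, namely $\sum_{n=m}^{2m}|\mathcal A_{n,m}|$. -/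

import Mathlib

open scoped Nat PowerSeries

namespace InvSeq

/-! Sequences are functions on `Fin n`, so positions are numbered from `0`: the entry at
`i : Fin n` is the `(i + 1)`-st entry of the sequence. -/

/-- Inversion sequences: the `(i + 1)`-st entry lies in `{0, …, i}`. -/
def IsInvSeq {n : ℕ} (σ : Fin n → ℕ) : Prop :=
  ∀ i : Fin n, σ i ≤ (i : ℕ)

/-- Cayley permutations: the set of values is an initial segment `{0, …, max}` of `ℕ`. -/
def IsCayley {n : ℕ} (σ : Fin n → ℕ) : Prop :=
  ∀ i : Fin n, Set.Iic (σ i) ⊆ Set.range σ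

/-- `Contains ρ σ`: some subsequence of `σ` is order-isomorphic to `ρ`
(`σ` contains the pattern `ρ`, written `ρ ≼ σ`). -/
def Contains {k n : ℕ} (ρ : Fin k → ℕ) (σ : Fin n → ℕ) : Prop :=
  ∃ f : Fin k → Fin n, StrictMono f ∧ ∀ i j : Fin k, ρ i < ρ j ↔ σ (f i) < σ (f j)

/-- Members of `IP[ρ]`: inversion sequences that are Cayley permutations and contain `ρ`. -/
def InIP {k n : ℕ} (ρ : Fin k → ℕ) (σ : Fin n → ℕ) : Prop :=
  IsInvSeq σ ∧ IsCayley σ ∧ Contains ρ σ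

/-- `σ` is a `ρ`-minimal inversion sequence: a minimal element of `IP[ρ]` (whose members have
arbitrary lengths) for pattern containment. -/
def IsMinimalFor {k n : ℕ} (ρ : Fin k → ℕ) (σ : Fin n → ℕ) : Prop :=
  InIP ρ σ ∧ ∀ (l : ℕ) (τ : Fin l → ℕ), InIP ρ τ → Contains τ σ → Contains σ τ

/-- The maximum diagonal difference: the maximum of `σ_i - i + 1` over `i = 1, …, n`, that is,
of `σ i - i` with positions numbered from `0`. -/
def mdd {n : ℕ} [NeZero n] (σ : Fin n → ℕ) : ℤ :=
  Finset.univ.sup' ⟨0, Finset.mem_univ _⟩ fun i : Fin n => (σ i : ℤ) - ((i : ℕ) : ℤ)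

inductive Colour : Type
  | blue
  | red

/-- An inversion sequence of length `n` together with a colour for each value in `[0, n - 1]`. -/
@[ext]
structure ColouredInvSeq (n : ℕ) where
  val : Fin n → ℕ
  isInvSeq : IsInvSeq val
  colour : Fin n → Colour

/-- The set `A_{n,m}`: there are `m` blue and `n - m` red values in `[0, n - 1]`, and each red
value occurs at least twice. -/
def setA (n m : ℕ) : Set (ColouredInvSeq n) :=
  {s | {v | s.colour v = Colour.blue}.ncard = m ∧
    {v | s.colour v = Colour.red}.ncard = n - m ∧
    ∀ v : Fin n, s.colour v = Colour.red → 2 ≤ {i : Fin n | s.val i = (v : ℕ)}.ncard}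

/-- A rooted, non-plane tree whose nodes are labelled bijectively by `[0, n - 1]`, given by its
root and its parent function (with the convention that the parent of the root is the root). -/
@[ext]
structure RootedTree (n : ℕ) where
  root : Fin n
  parent : Fin n → Fin n
  parent_root : parent root = root
  reaches_root : ∀ v : Fin n, ∃ j : ℕ, parent^[j] v = root

/-- The set of children of a node. -/
def RootedTree.children {n : ℕ} (T : RootedTree n) (v : Fin n) : Set (Fin n) :=
  {w | w ≠ T.root ∧ T.parent w = v}

/-- Increasing trees: each non-root node has a greater label than its parent. -/
def RootedTree.IsIncreasing {n : ℕ} (T : RootedTree n) : Prop :=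
  ∀ v : Fin n, v ≠ T.root → T.parent v < v

@[ext]
structure ColouredTree (n : ℕ) where
  tree : RootedTree n
  colour : Fin n → Colour

/-- The set `B_{n,m}`: coloured increasing trees on `n` nodes with `m` blue nodes and `n - m` red
nodes, such that each red node has at least two children. -/
def setB (n m : ℕ) : Set (ColouredTree n) :=
  {t | t.tree.IsIncreasing ∧
    {v | t.colour v = Colour.blue}.ncard = m ∧
    {v | t.colour v = Colour.red}.ncard = n - m ∧
    ∀ v : Fin n, t.colour v = Colour.red → 2 ≤ (t.tree.children v).ncard}

/-- The parent function on `[0, n]` sending `0` to `0` and the label `i + 1` to the `(i + 1)`-st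
entry of `σ`. -/
def phiParent {n : ℕ} (σ : Fin n → ℕ) (h : IsInvSeq σ) : Fin (n + 1) → Fin (n + 1) :=
  Fin.cons 0 fun i : Fin n => ⟨σ i, (h i).trans_lt (i.isLt.trans (Nat.lt_succ_self n))⟩

theorem phiParent_reaches {n : ℕ} (σ : Fin n → ℕ) (h : IsInvSeq σ) :
    ∀ (b : ℕ) (v : Fin (n + 1)), (v : ℕ) ≤ b → ∃ j : ℕ, (phiParent σ h)^[j] v = 0 := by
  intro b
  induction b with
  | zero =>
    intro v hv
    exact ⟨0, Fin.ext (Nat.le_zero.mp hv)⟩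
  | succ b ih =>
    intro v hv
    induction v using Fin.cases with
    | zero => exact ⟨0, rfl⟩
    | succ i =>
      have h1 : ((phiParent σ h i.succ : Fin (n + 1)) : ℕ) ≤ b := by
        have h2 := h i
        have h3 : (i : ℕ) + 1 ≤ b + 1 := by simpa using hv
        have h4 : ((phiParent σ h i.succ : Fin (n + 1)) : ℕ) = σ i := by simp [phiParent]
        omega
      obtain ⟨j, hj⟩ := ih _ h1
      exact ⟨j + 1, by rw [Function.iterate_succ_apply]; exact hj⟩

/-- The map `φ` from coloured inversion sequences of length `n` to coloured trees on `[0, n]`: the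
root is `0`, the children of `v` are the positions (numbered from `1`) of the value `v`, each
`v < n` keeps its colour, and `n` is blue. -/
def phi {n : ℕ} (s : ColouredInvSeq n) : ColouredTree (n + 1) where
  tree :=
    { root := 0
      parent := phiParent s.val s.isInvSeq
      parent_root := rfl
      reaches_root := fun v => phiParent_reaches s.val s.isInvSeq v v le_rfl }
  colour := Fin.snoc (α := fun _ => Colour) s.colour Colour.blue

/-- The generating function `B(x, y) = ∑_{n, m ≥ 1} |B_{n,m}| / n! * x ^ n * y ^ m`, as an element
of `ℚ⟦y⟧⟦x⟧`: the outer variable is `x`, and the inner variable is `y`. -/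
noncomputable def genB : ℚ⟦X⟧⟦X⟧ :=
  PowerSeries.mk fun n => PowerSeries.mk fun m =>
    if 1 ≤ n ∧ 1 ≤ m then ((setB n m).ncard : ℚ) / (n ! : ℚ) else 0

end InvSeq

/-!
If `B' = f(B)` and `B(0) = 0`, then `f⁽ᶜ⁾(B)' = f⁽ᶜ⁺¹⁾(B) f(B)`: differentiating a product of
factors `f⁽ᶜ⁾(B)` attaches a new leaf to each node of an increasing tree in turn. Hence
`(n + 1)! [x ^ (n + 1)] B` is the sum over increasing trees on `n + 1` nodes of the product of
`c! [X ^ c] f` over the numbers `c` of children. For `f = (y + 1) e ^ X - X - 1` this factor is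
`y + 1` if `2 ≤ c` and `y` otherwise, the generating function of the colours allowed at the node.

Deleting an entry outside an occurrence of `ρ` and standardizing yields a smaller inversion
sequence containing `ρ`, unless the value of the entry is repeated and a later entry lies on the
diagonal. In a minimal sequence of length `n + k`, counting the values missing from the occurrence
then forces the occurrence to be the suffix of length `k`, starting on the diagonal, while the
values of the prefix are repeated. Conversely, no such sequence contains a shorter one, so all of
them are minimal. They are determined by the prefix together with the set of those values `v < n`
that occur in the suffix: these are the `ρ 0` blue values, and every other value occurs twice in
the prefix.
-/

namespace InvSeq

section IncreasingTreeEquation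

open PowerSeries

theorem derivation_prod {R A M ι : Type*} [CommSemiring R] [CommSemiring A] [AddCommMonoid M]
    [Algebra R A] [Module A M] [Module R M] [DecidableEq ι] (D : Derivation R A M)
    (s : Finset ι) (f : ι → A) :
    D (∏ i ∈ s, f i) = ∑ i ∈ s, (∏ j ∈ s.erase i, f j) • D (f i) := by
  induction s using Finset.induction_on with
  | empty => simp
  | insert a s ha ih =>
    have hsummand : ∀ i ∈ s, f a • (∏ j ∈ s.erase i, f j) • D (f i) =
        (∏ j ∈ (insert a s).erase i, f j) • D (f i) := fun i hi => by
      have hai : a ≠ i := fun h => ha (h ▸ hi)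
      rw [Finset.erase_insert_of_ne hai,
        Finset.prod_insert fun h => ha (Finset.mem_of_mem_erase h), mul_smul]
    rw [Finset.prod_insert ha, D.leibniz, ih, Finset.smul_sum, Finset.sum_congr rfl hsummand,
      Finset.sum_insert ha, Finset.erase_insert ha, add_comm]

/-- Inversion sequences of length `n`, as a finite type. -/
abbrev InvFn (n : ℕ) : Type := (i : Fin n) → Fin (i.val + 1)

/-- The number of occurrences of the value `v` in the inversion sequence `a`, that is, the number
of children of the node `v` in the increasing tree on `[0, n]` corresponding to `a`. -/
def mult {n : ℕ} (a : InvFn n) (v : ℕ) : ℕ := ∑ i, if (a i : ℕ) = v then 1 else 0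

theorem mult_snoc {n : ℕ} (a : InvFn n) (x : Fin (n + 1)) (v : ℕ) :
    mult (n := n + 1) (Fin.snoc (α := fun i : Fin (n + 1) => Fin (i.val + 1)) a x) v =
      mult a v + if (x : ℕ) = v then 1 else 0 := by
  rw [mult, Fin.sum_univ_castSucc, mult, Fin.snoc_last]
  simp only [Fin.snoc_castSucc]

theorem mult_of_le {n : ℕ} (a : InvFn n) {v : ℕ} (h : n ≤ v) : mult a v = 0 :=
  Finset.sum_eq_zero fun i _ => if_neg (by have := (a i).isLt; have := i.isLt; omega)

theorem sum_invFn_succ {M : Type*} [AddCommMonoid M] {n : ℕ} (g : InvFn (n + 1) → M) :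
    ∑ a, g a = ∑ a : InvFn n, ∑ x : Fin (n + 1),
      g (Fin.snoc (α := fun i : Fin (n + 1) => Fin (i.val + 1)) a x) := by
  rw [← (Fin.snocEquiv (fun i : Fin (n + 1) => Fin (i.val + 1))).sum_comp, Fintype.sum_prod_type,
    Finset.sum_comm]
  rfl

-- Attaching the node `n + 1` to the node `x` replaces the factor `P c` of `x` by `P (c + 1)` and
-- adds the factor `P 0` of a leaf, which is the effect of `D` on the factor of `x`.
theorem iterate_derivation_eq_sum {R A : Type*} [CommSemiring R] [CommSemiring A] [Algebra R A]
    (D : Derivation R A A) (P : ℕ → A) (hP : ∀ c, D (P c) = P (c + 1) * P 0) (n : ℕ) :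
    D^[n] (P 0) = ∑ a : InvFn n, ∏ v ∈ Finset.range (n + 1), P (mult a v) := by
  induction n with
  | zero => simp [mult]
  | succ n ih =>
    rw [Function.iterate_succ_apply', ih, map_sum, sum_invFn_succ]
    refine Finset.sum_congr rfl fun a _ => ?_
    rw [derivation_prod, Finset.sum_range]
    refine Finset.sum_congr rfl fun x _ => ?_
    have hother : ∀ v ∈ (Finset.range (n + 1)).erase (x : ℕ),
        P (mult a v + if (x : ℕ) = v then 1 else 0) = P (mult a v) := fun v hv => by
      rw [if_neg (Finset.ne_of_mem_erase hv).symm, add_zero]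
    have hleaf : mult a (n + 1) + (if (x : ℕ) = n + 1 then 1 else 0) = 0 := by
      rw [mult_of_le a n.le_succ, if_neg (by omega)]
    simp only [mult_snoc]
    rw [Finset.prod_range_succ, hleaf,
      ← Finset.mul_prod_erase (Finset.range (n + 1)) _ (Finset.mem_range.2 x.isLt), if_pos rfl,
      Finset.prod_congr rfl hother, hP, smul_eq_mul]
    ring

variable {A : Type*} [CommRing A]

theorem constantCoeff_subst_of_constantCoeff_eq_zero {F : A⟦X⟧} (hF : constantCoeff F = 0)
    (f : A⟦X⟧) : constantCoeff (f.subst F) = constantCoeff f := by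
  rw [← coeff_zero_eq_constantCoeff_apply, coeff_subst' (HasSubst.of_constantCoeff_zero' hF),
    finsum_eq_single _ 0 fun d hd => by simp [hF, hd]]
  simp

theorem factorial_mul_coeff_of_derivative_eq_subst {f B : A⟦X⟧} (hB0 : constantCoeff B = 0)
    (hB : d⁄dX A B = f.subst B) (n : ℕ) :
    ((n + 1)! : A) * coeff (n + 1) B = ∑ a : InvFn n, ∏ v ∈ Finset.range (n + 1),
      ((mult a v)! : A) * coeff (mult a v) f := by
  have hP : ∀ c, d⁄dX A (((d⁄dX A)^[c] f).subst B) =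
      ((d⁄dX A)^[c + 1] f).subst B * ((d⁄dX A)^[0] f).subst B := fun c => by
    rw [derivative_subst (HasSubst.of_constantCoeff_zero' hB0), hB, Function.iterate_succ_apply',
      Function.iterate_zero_apply]
  have h := iterate_derivation_eq_sum (d⁄dX A) (fun c => ((d⁄dX A)^[c] f).subst B) hP n
  rw [Function.iterate_zero_apply, ← hB, ← Function.iterate_succ_apply] at h
  rw [← constantCoeff_iterate_derivative, h]
  simp only [map_sum, map_prod, constantCoeff_subst_of_constantCoeff_eq_zero hB0,
    constantCoeff_iterate_derivative]

theorem coeff_subst_congr {F G : A⟦X⟧} (hF : constantCoeff F = 0) (hG : constantCoeff G = 0)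
    {n : ℕ} (h : ∀ i ≤ n, coeff i F = coeff i G) (f : A⟦X⟧) :
    coeff n (f.subst F) = coeff n (f.subst G) := by
  have hdvd : X ^ (n + 1) ∣ F - G := X_pow_dvd_iff.2 fun i hi => by
    rw [map_sub, h i (Nat.lt_succ_iff.1 hi), sub_self]
  have hpow : ∀ d, coeff n (F ^ d) = coeff n (G ^ d) := fun d => by
    rw [← sub_eq_zero, ← map_sub]
    exact X_pow_dvd_iff.1 (hdvd.trans (sub_dvd_pow_sub_pow F G d)) n n.lt_succ_self
  rw [coeff_subst' (HasSubst.of_constantCoeff_zero' hF),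
    coeff_subst' (HasSubst.of_constantCoeff_zero' hG)]
  simp only [hpow]

/-- The coefficients of the solution of `B' = f(B)`, `B(0) = 0`: the coefficient of `X ^ n` in
`f(B)`, hence that of `X ^ (n + 1)` in `B`, depends only on the coefficients up to `X ^ n`. -/
noncomputable def solutionCoeff [Algebra ℚ A] (f : A⟦X⟧) : ℕ → A
  | 0 => 0
  | n + 1 => (n + 1 : ℚ)⁻¹ •
      coeff n (f.subst (mk fun i => if _ : i < n + 1 then solutionCoeff f i else 0))

theorem exists_derivative_eq_subst [Algebra ℚ A] (f : A⟦X⟧) :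
    ∃ B : A⟦X⟧, constantCoeff B = 0 ∧ d⁄dX A B = f.subst B := by
  have hB0 : constantCoeff (mk (solutionCoeff f)) = 0 := by
    rw [← coeff_zero_eq_constantCoeff_apply, coeff_mk, solutionCoeff]
  refine ⟨mk (solutionCoeff f), hB0, PowerSeries.ext fun n => ?_⟩
  have hcast : (n : A) + 1 = algebraMap ℚ A (n + 1) := by simp
  rw [coeff_derivative, coeff_mk, solutionCoeff, smul_mul_assoc, mul_comm, hcast,
    ← Algebra.smul_def, inv_smul_smul₀ (by positivity)]
  refine coeff_subst_congr ?_ hB0 (fun i hi => ?_) f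
  · rw [← coeff_zero_eq_constantCoeff_apply, coeff_mk, dif_pos n.succ_pos, solutionCoeff]
  · rw [coeff_mk, coeff_mk, dif_pos (Nat.lt_succ_iff.2 hi)]

/-- The generating function of the colours allowed at a node with `c` children, a blue node
counting `y`. -/
def nodeWeight (y : A) (c : ℕ) : A := y + if 2 ≤ c then 1 else 0

theorem factorial_mul_coeff_exp_sub [Algebra ℚ A] (y : A) (c : ℕ) :
    (c ! : A) * coeff c ((C y + 1) * exp A - X - 1) = nodeWeight y c := by
  have hexp : (c ! : A) * algebraMap ℚ A (1 / c !) = 1 := by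
    rw [← map_natCast (algebraMap ℚ A), ← map_mul, mul_one_div_cancel (by positivity), map_one]
  rw [add_mul, one_mul, map_sub, map_sub, map_add, coeff_C_mul, coeff_exp, mul_sub, mul_sub,
    mul_add, mul_left_comm, hexp, nodeWeight]
  match c with
  | 0 => simp [coeff_X, coeff_one]
  | 1 => simp [coeff_X, coeff_one]
  | c + 2 => simp [coeff_X, coeff_one]

theorem exists_derivative_eq_exp [Algebra ℚ A] (y : A) : ∃ B : A⟦X⟧, constantCoeff B = 0 ∧
    d⁄dX A B = (C y + 1) * (exp A).subst B - B - 1 ∧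
    ∀ n : ℕ, ((n + 1)! : A) * coeff (n + 1) B =
      ∑ a : InvFn n, ∏ v ∈ Finset.range (n + 1), nodeWeight y (mult a v) := by
  obtain ⟨B, hB0, hB⟩ := exists_derivative_eq_subst ((C y + 1) * exp A - X - 1)
  have hs : HasSubst B := HasSubst.of_constantCoeff_zero' hB0
  refine ⟨B, hB0, ?_, fun n => ?_⟩
  · rw [hB, ← coe_substAlgHom hs]
    simp only [map_sub, map_mul, map_add, map_one, coe_substAlgHom hs, subst_X hs]
    rw [subst_C]
    rfl
  · simp only [factorial_mul_coeff_of_derivative_eq_subst hB0 hB, factorial_mul_coeff_exp_sub]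

end IncreasingTreeEquation

section TreeBijection

variable {n m : ℕ}

theorem Colour.eq_red_iff {c : Colour} : c = Colour.red ↔ c ≠ Colour.blue := by
  cases c <;> simp

theorem ncard_red (c : Fin n → Colour) :
    {v | c v = Colour.red}.ncard = n - {v | c v = Colour.blue}.ncard := by
  have hcompl : {v | c v = Colour.red} = {v | c v = Colour.blue}ᶜ :=
    Set.ext fun v => Colour.eq_red_iff
  rw [hcompl, Set.ncard_compl, Nat.card_eq_fintype_card, Fintype.card_fin]

theorem mem_setA_iff {s : ColouredInvSeq n} : s ∈ setA n m ↔
    {v | s.colour v = Colour.blue}.ncard = m ∧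
      ∀ v, s.colour v = Colour.red → 2 ≤ {i | s.val i = (v : ℕ)}.ncard :=
  ⟨fun h => ⟨h.1, h.2.2⟩, fun h => ⟨h.1, by rw [ncard_red, h.1], h.2⟩⟩

theorem mem_setB_iff {t : ColouredTree n} : t ∈ setB n m ↔
    t.tree.IsIncreasing ∧ {v | t.colour v = Colour.blue}.ncard = m ∧
      ∀ v, t.colour v = Colour.red → 2 ≤ (t.tree.children v).ncard :=
  ⟨fun h => ⟨h.1, h.2.1, h.2.2.2⟩, fun h => ⟨h.1, h.2.1, by rw [ncard_red, h.2.1], h.2.2⟩⟩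

theorem ncard_blue_snoc_blue (c : Fin n → Colour) :
    {v | Fin.snoc (α := fun _ => Colour) c Colour.blue v = Colour.blue}.ncard =
      {v | c v = Colour.blue}.ncard + 1 := by
  have hinsert : {v | Fin.snoc (α := fun _ => Colour) c Colour.blue v = Colour.blue} =
      insert (Fin.last n) (Fin.castSucc '' {v | c v = Colour.blue}) := by
    ext v
    induction v using Fin.lastCases with
    | last => simp
    | cast v => simp [Fin.castSucc_ne_last]
  rw [hinsert, Set.ncard_insert_of_notMem,
    Set.ncard_image_of_injective _ (Fin.castSucc_injective n)]
  rintro ⟨v, -, hv⟩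
  exact Fin.castSucc_ne_last v hv

theorem isIncreasing_phi (s : ColouredInvSeq n) : (phi s).tree.IsIncreasing := fun v hv => by
  induction v using Fin.cases with
  | zero => exact absurd rfl hv
  | succ i => exact Fin.lt_def.2 (Nat.lt_succ_iff.2 (s.isInvSeq i))

theorem phi_children (s : ColouredInvSeq n) (v : Fin (n + 1)) :
    (phi s).tree.children v = Fin.succ '' {i | s.val i = (v : ℕ)} := by
  ext w
  induction w using Fin.cases with
  | zero => simp [RootedTree.children, phi]
  | succ i =>
    rw [(Fin.succ_injective n).mem_set_image]
    exact (and_iff_right (Fin.succ_ne_zero i)).trans Fin.ext_iff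

theorem phi_colour_castSucc (s : ColouredInvSeq n) (v : Fin n) :
    (phi s).colour v.castSucc = s.colour v :=
  Fin.snoc_castSucc (α := fun _ => Colour) Colour.blue s.colour v

theorem phi_colour_last (s : ColouredInvSeq n) : (phi s).colour (Fin.last n) = Colour.blue :=
  Fin.snoc_last (α := fun _ => Colour) Colour.blue s.colour

theorem phi_mem_setB_iff {s : ColouredInvSeq n} :
    phi s ∈ setB (n + 1) (m + 1) ↔ s ∈ setA n m := by
  have hblue : {v | (phi s).colour v = Colour.blue}.ncard =
      {v | s.colour v = Colour.blue}.ncard + 1 := ncard_blue_snoc_blue s.colour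
  rw [mem_setB_iff, mem_setA_iff, and_iff_right (isIncreasing_phi s), hblue, Nat.succ_inj,
    Fin.forall_fin_succ']
  simp [phi_colour_castSucc, phi_colour_last, phi_children,
    Set.ncard_image_of_injective _ (Fin.succ_injective n)]

theorem phi_injective : Function.Injective (phi (n := n)) := fun s t h => by
  have hparent : (phi s).tree.parent = (phi t).tree.parent := by rw [h]
  have hcolour : (phi s).colour = (phi t).colour := by rw [h]
  refine ColouredInvSeq.ext (funext fun i => ?_) (funext fun v => ?_)
  · exact congrArg Fin.val (congrFun hparent i.succ)
  · simpa only [phi_colour_castSucc] using congrFun hcolour v.castSucc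

namespace RootedTree.IsIncreasing

variable {T : RootedTree (n + 1)}

theorem root_eq_zero (h : T.IsIncreasing) : T.root = 0 := by
  by_contra hne
  exact absurd (h 0 (Ne.symm hne)) (Fin.not_lt_zero _)

theorem parent_succ_le (h : T.IsIncreasing) (i : Fin n) : (T.parent i.succ : ℕ) ≤ i :=
  Nat.lt_succ_iff.1 (h i.succ (h.root_eq_zero ▸ Fin.succ_ne_zero i))

theorem children_last (h : T.IsIncreasing) : T.children (Fin.last n) = ∅ :=
  Set.eq_empty_of_forall_notMem fun w hw =>
    absurd (Fin.le_last w) (not_le.2 (hw.2 ▸ h w hw.1))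

end RootedTree.IsIncreasing

theorem colour_last_of_mem_setB {t : ColouredTree (n + 1)} (ht : t ∈ setB (n + 1) m) :
    t.colour (Fin.last n) = Colour.blue := by
  by_contra hne
  have hchildren := ht.2.2.2 _ (Colour.eq_red_iff.2 hne)
  rw [ht.1.children_last, Set.ncard_empty] at hchildren
  omega

/-- The inverse of `phi`: the sequence of the parents of the nodes `1, …, n` of an increasing tree,
with the colours of the nodes `0, …, n - 1`. -/
def ofTree (t : ColouredTree (n + 1)) (h : t.tree.IsIncreasing) : ColouredInvSeq n where
  val i := t.tree.parent i.succ
  isInvSeq := h.parent_succ_le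
  colour v := t.colour v.castSucc

theorem phi_ofTree {t : ColouredTree (n + 1)} (h : t.tree.IsIncreasing)
    (hlast : t.colour (Fin.last n) = Colour.blue) : phi (ofTree t h) = t := by
  have hroot := h.root_eq_zero
  refine ColouredTree.ext (RootedTree.ext hroot.symm (funext fun v => ?_)) (funext fun v => ?_)
  · induction v using Fin.cases with
    | zero => exact (hroot ▸ t.tree.parent_root).symm
    | succ i => rfl
  · induction v using Fin.lastCases with
    | last => rw [phi_colour_last, hlast]
    | cast v => rw [phi_colour_castSucc, ofTree]

theorem bijOn_phi (n m : ℕ) : Set.BijOn phi (setA n m) (setB (n + 1) (m + 1)) := by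
  refine ⟨fun s => phi_mem_setB_iff.2, phi_injective.injOn, fun t ht => ?_⟩
  have hphi := phi_ofTree ht.1 (colour_last_of_mem_setB ht)
  exact ⟨ofTree t ht.1, phi_mem_setB_iff.1 (hphi.symm ▸ ht), hphi⟩

theorem ncard_setA_eq_ncard_setB (n m : ℕ) :
    (setA n m).ncard = (setB (n + 1) (m + 1)).ncard := by
  rw [← (bijOn_phi n m).image_eq, Set.ncard_image_of_injective _ phi_injective]

end TreeBijection

section GeneratingFunction

open PowerSeries

theorem mult_eq_ncard {n : ℕ} (a : InvFn n) (v : ℕ) :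
    mult a v = {i : Fin n | (a i : ℕ) = v}.ncard := by
  rw [mult, Finset.sum_boole, Set.ncard_eq_toFinset_card']
  simp

instance : DecidableEq Colour
  | .blue, .blue | .red, .red => isTrue rfl
  | .blue, .red | .red, .blue => isFalse nofun

instance : Fintype Colour := ⟨{.blue, .red}, by rintro (_ | _) <;> simp⟩

theorem nodeWeight_eq_sum {A : Type*} [CommRing A] (y : A) (c : ℕ) : nodeWeight y c =
    ∑ d : Colour, if d = .red → 2 ≤ c then (if d = .blue then y else 1) else 0 := by
  change _ = ∑ d ∈ {Colour.blue, Colour.red}, _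
  simp [nodeWeight]

theorem prod_nodeWeight {A : Type*} [CommRing A] (y : A) {n : ℕ} (a : InvFn n) :
    ∏ v : Fin n, nodeWeight y (mult a v) =
      ∑ c : Fin n → Colour, if ∀ v : Fin n, c v = .red → 2 ≤ mult a v then
        y ^ {v | c v = .blue}.ncard else 0 := by
  simp only [nodeWeight_eq_sum, Fintype.prod_sum, Fintype.prod_ite_zero]
  refine Finset.sum_congr rfl fun c _ => ?_
  rw [Finset.prod_ite, Finset.prod_const_one, mul_one, Finset.prod_const, ← Set.ncard_coe_finset,
    Finset.coe_filter_univ]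
  congr

/-- A coloured inversion sequence is an inversion sequence together with a colouring. -/
def colouredInvSeqEquiv (n : ℕ) : ColouredInvSeq n ≃ InvFn n × (Fin n → Colour) where
  toFun s := (fun i => ⟨s.val i, Nat.lt_succ_iff.2 (s.isInvSeq i)⟩, s.colour)
  invFun p := ⟨fun i => p.1 i, fun i => Nat.lt_succ_iff.1 (p.1 i).isLt, p.2⟩
  left_inv _ := rfl
  right_inv _ := rfl

theorem ncard_setA (n m : ℕ) : (setA n m).ncard = ∑ a : InvFn n, ∑ c : Fin n → Colour,
    if (∀ v : Fin n, c v = .red → 2 ≤ mult a v) ∧ {v | c v = .blue}.ncard = m then 1 else 0 := by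
  have himage : colouredInvSeqEquiv n '' setA n m =
      {p | (∀ v : Fin n, p.2 v = .red → 2 ≤ mult p.1 v) ∧ {v | p.2 v = .blue}.ncard = m} := by
    rw [Equiv.image_eq_preimage_symm]
    ext p
    simp only [Set.mem_preimage, mem_setA_iff, Set.mem_ofPred_eq, mult_eq_ncard]
    exact and_comm
  rw [← Set.ncard_image_of_injective _ (colouredInvSeqEquiv n).injective, himage,
    Set.ncard_eq_toFinset_card', Set.toFinset_ofPred, Finset.card_filter, Fintype.sum_prod_type]

theorem coeff_sum_prod_nodeWeight (n m : ℕ) :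
    coeff m (∑ a : InvFn n, ∏ v : Fin n, nodeWeight (X : ℚ⟦X⟧) (mult a v)) =
      (setA n m).ncard := by
  simp only [prod_nodeWeight, ncard_setA, map_sum, Nat.cast_sum, apply_ite (coeff m),
    coeff_X_pow, map_zero, ite_and, Nat.cast_ite, Nat.cast_one, Nat.cast_zero, eq_comm]

theorem coeff_coeff_genB (n m : ℕ) :
    ((n + 1)! : ℚ) * coeff (m + 1) (coeff (n + 1) genB) = ((setB (n + 1) (m + 1)).ncard : ℚ) := by
  rw [genB, coeff_mk, coeff_mk, if_pos ⟨by omega, by omega⟩, mul_div_cancel₀ _ (by positivity)]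

theorem factorial_mul_coeff_genB (n : ℕ) : ((n + 1)! : ℚ⟦X⟧) * coeff (n + 1) genB =
    ∑ a : InvFn n, ∏ v ∈ Finset.range (n + 1), nodeWeight X (mult a v) := by
  have hlast : ∀ a : InvFn n, ∏ v ∈ Finset.range (n + 1), nodeWeight (X : ℚ⟦X⟧) (mult a v) =
      (∏ v : Fin n, nodeWeight X (mult a v)) * X := fun a => by
    rw [Finset.prod_range_succ, mult_of_le a le_rfl, Finset.prod_range]
    simp [nodeWeight]
  simp only [hlast, ← Finset.sum_mul]
  ext m
  rw [← nsmul_eq_mul, map_nsmul, nsmul_eq_mul]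
  cases m with
  | zero => simp [genB]
  | succ m => rw [coeff_coeff_genB, coeff_succ_mul_X, coeff_sum_prod_nodeWeight,
      ncard_setA_eq_ncard_setB]

theorem genB_differential_equation :
    d⁄dX ℚ⟦X⟧ genB = (C X + 1) * (exp ℚ⟦X⟧).subst genB - genB - 1 ∧ constantCoeff genB = 0 := by
  obtain ⟨B, hB0, hB, hcoeff⟩ := exists_derivative_eq_exp (X : ℚ⟦X⟧)
  have := algebraRat.charZero ℚ⟦X⟧
  have hgenB0 : constantCoeff genB = 0 := by ext m; simp [genB]
  have hgenB : genB = B := by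
    ext n : 1
    cases n with
    | zero => simp [hB0, hgenB0]
    | succ n =>
      refine mul_left_cancel₀ (Nat.cast_ne_zero.2 (n + 1).factorial_ne_zero) ?_
      rw [hcoeff, factorial_mul_coeff_genB]
  exact hgenB ▸ ⟨hB, hB0⟩

end GeneratingFunction

section OrderIsomorphism

variable {ι : Type*} {L M N : Type*} [LinearOrder L] [LinearOrder M] [LinearOrder N]

/-- Order-isomorphic families, so that `Contains ρ σ` holds if `ρ` is order-isomorphic to `σ ∘ f`
for some strictly monotone `f`. -/
def SameOrder (α : ι → L) (β : ι → M) : Prop := ∀ i j, α i < α j ↔ β i < β j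

namespace SameOrder

variable {α : ι → L} {β : ι → M} {γ : ι → N}

theorem symm (h : SameOrder α β) : SameOrder β α := fun i j => (h i j).symm

theorem trans (h : SameOrder α β) (h' : SameOrder β γ) : SameOrder α γ :=
  fun i j => (h i j).trans (h' i j)

theorem le_iff (h : SameOrder α β) (i j : ι) : α i ≤ α j ↔ β i ≤ β j := by
  rw [← not_lt, ← not_lt, h]

theorem eq_iff (h : SameOrder α β) (i j : ι) : α i = α j ↔ β i = β j := by
  rw [le_antisymm_iff, le_antisymm_iff, h.le_iff, h.le_iff]

theorem card_image_le (h : SameOrder α β) (s : Finset ι) : (s.image β).card ≤ (s.image α).card := by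
  rcases isEmpty_or_nonempty M with _ | _
  · simp [Finset.eq_empty_of_isEmpty (s.image β)]
  obtain ⟨g, rfl⟩ := (Function.factorsThrough_iff β).1 fun i j => (h.eq_iff i j).1
  rw [← Finset.image_image]
  exact Finset.card_image_le

theorem card_image (h : SameOrder α β) (s : Finset ι) : (s.image α).card = (s.image β).card :=
  (h.symm.card_image_le s).antisymm (h.card_image_le s)

theorem sub_le_card_missing [Fintype ι] {α β : ι → ℕ} (h : SameOrder α β) (i j : ι) :
    β j - β i ≤ α j - α i + (Finset.Ico (β i) (β j) \ Finset.univ.image β).card := by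
  have hattained : (Finset.Ico (β i) (β j) ∩ Finset.univ.image β).card ≤ α j - α i :=
    calc (Finset.Ico (β i) (β j) ∩ Finset.univ.image β).card
      _ = ((Finset.univ.filter fun l => β l ∈ Finset.Ico (β i) (β j)).image β).card := by
        rw [Finset.inter_comm, ← Finset.filter_mem_eq_inter, Finset.filter_image]
      _ = ((Finset.univ.filter fun l => α l ∈ Finset.Ico (α i) (α j)).image α).card := by
        simp only [Finset.mem_Ico, ← h.le_iff, ← h _ _, h.card_image]
      _ ≤ (Finset.Ico (α i) (α j)).card :=
        Finset.card_le_card (Finset.image_subset_iff.2 fun l hl => (Finset.mem_filter.1 hl).2)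
      _ = α j - α i := Nat.card_Ico _ _
  rw [← Nat.card_Ico, ← Finset.card_inter_add_card_sdiff (Finset.Ico (β i) (β j))
    (Finset.univ.image β)]
  exact Nat.add_le_add_right hattained _

end SameOrder

end OrderIsomorphism

section Containment

variable {a b c : ℕ} {α : Fin a → ℕ} {β : Fin b → ℕ} {γ : Fin c → ℕ}

theorem Contains.trans (h : Contains α β) (h' : Contains β γ) : Contains α γ := by
  obtain ⟨f, hf, hαβ⟩ := h
  obtain ⟨g, hg, hβγ⟩ := h'
  exact ⟨g ∘ f, hg.comp hf, fun i j => (hαβ i j).trans (hβγ _ _)⟩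

theorem Contains.length_le (h : Contains α β) : a ≤ b := by
  obtain ⟨f, hf, -⟩ := h
  simpa using Fintype.card_le_of_injective f hf.injective

theorem SameOrder.contains {β : Fin a → ℕ} (h : SameOrder α β) : Contains α β :=
  ⟨id, strictMono_id, h⟩

theorem Contains.sameOrder {β : Fin a → ℕ} (h : Contains α β) : SameOrder α β := by
  obtain ⟨f, hf, hαβ⟩ := h
  have hid : f = id := (StrictMono.range_inj hf strictMono_id).1 (by
    rw [Set.range_id, (Finite.injective_iff_surjective.1 hf.injective).range_eq])
  subst hid
  exact hαβ

theorem InIP.exists_isMinimalFor {k N : ℕ} {ρ : Fin k → ℕ} {τ : Fin N → ℕ} (hτ : InIP ρ τ) :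
    ∃ (l : ℕ) (τ' : Fin l → ℕ), IsMinimalFor ρ τ' ∧ Contains τ' τ := by
  induction N using Nat.strong_induction_on with
  | _ N ih =>
    by_cases hmin : IsMinimalFor ρ τ
    · exact ⟨N, τ, hmin, id, strictMono_id, fun _ _ => Iff.rfl⟩
    obtain ⟨l, τ₁, hτ₁, hle, hnle⟩ : ∃ (l : ℕ) (τ₁ : Fin l → ℕ),
        InIP ρ τ₁ ∧ Contains τ₁ τ ∧ ¬ Contains τ τ₁ := by
      by_contra! hcon
      exact hmin ⟨hτ, hcon⟩
    rcases hle.length_le.eq_or_lt with rfl | hlt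
    · exact absurd hle.sameOrder.symm.contains hnle
    obtain ⟨l', τ', hτ', hle'⟩ := ih l hlt hτ₁
    exact ⟨l', τ', hτ', hle'.trans hle⟩

end Containment

section Standardization

theorem IsCayley.card_image_filter_lt {k : ℕ} {ρ : Fin k → ℕ} (hρ : IsCayley ρ) (j : Fin k) :
    ((Finset.univ.filter fun i => ρ i < ρ j).image ρ).card = ρ j := by
  have hrange : (Finset.univ.filter fun i => ρ i < ρ j).image ρ = Finset.range (ρ j) := by
    ext v
    simp only [Finset.mem_image, Finset.mem_filter, Finset.mem_univ, true_and, Finset.mem_range]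
    refine ⟨fun ⟨_, hi, hiv⟩ => hiv ▸ hi, fun hv => ?_⟩
    obtain ⟨i, rfl⟩ := hρ j hv.le
    exact ⟨i, hv, rfl⟩
  rw [hrange, Finset.card_range]

theorem IsCayley.eq_of_sameOrder {k : ℕ} {ρ σ : Fin k → ℕ} (hρ : IsCayley ρ) (hσ : IsCayley σ)
    (h : SameOrder ρ σ) : ρ = σ := funext fun j => by
  rw [← hρ.card_image_filter_lt, ← hσ.card_image_filter_lt, h.card_image]
  simp only [h _ j]

/-- The standardization of `σ`, which is the Cayley permutation order-isomorphic to `σ`: each entry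
is replaced by the number of distinct values below it. -/
def std {k : ℕ} (σ : Fin k → ℕ) (i : Fin k) : ℕ := Nat.count (fun v => ∃ l, σ l = v) (σ i)

variable {k : ℕ} (σ : Fin k → ℕ)

theorem std_le (i : Fin k) : std σ i ≤ σ i := Nat.count_le _

theorem sameOrder_std : SameOrder (std σ) σ := fun i _ =>
  ⟨fun h => lt_of_not_ge fun h' => absurd (Nat.count_monotone _ h') (not_le.2 h),
    Nat.count_strict_mono ⟨i, rfl⟩⟩

theorem isCayley_std : IsCayley (std σ) := fun j v hv => by
  have hlt : ∀ hfin : (Set.ofPred fun v => ∃ l, σ l = v).Finite, v < hfin.toFinset.card :=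
    fun hfin => (Set.mem_Iic.1 hv).trans_lt (Nat.count_lt_card hfin ⟨j, rfl⟩)
  obtain ⟨i, hi⟩ := Nat.nth_mem v hlt
  exact ⟨i, by rw [std, hi, Nat.count_nth hlt]⟩

variable {σ}

theorem std_eq_of_sameOrder {ρ : Fin k → ℕ} (hρ : IsCayley ρ) (h : SameOrder ρ σ) : std σ = ρ :=
  ((isCayley_std σ).eq_of_sameOrder hρ ((sameOrder_std σ).trans h.symm))

theorem std_lt_of_missing {i : Fin k} {v : ℕ} (hv : v < σ i) (hmissing : ∀ l, σ l ≠ v) :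
    std σ i < σ i :=
  (Nat.count_le _).lt_of_ne fun h => by
    obtain ⟨l, hl⟩ := Nat.count_iff_forall.1 h v hv
    exact hmissing l hl

end Standardization

section Deletion

variable {k N : ℕ} {ρ : Fin k → ℕ}

theorem isInvSeq_std_deletion {σ : Fin (N + 1) → ℕ} (hσ : IsInvSeq σ) {p : Fin (N + 1)}
    (h : ∀ l, p < l → σ l = (l : ℕ) → ∀ q, q ≠ p → σ q ≠ σ p) :
    IsInvSeq (std (σ ∘ p.succAbove)) := fun j => by
  have hle : std (σ ∘ p.succAbove) j ≤ σ (p.succAbove j) := std_le _ j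
  rcases lt_or_ge j.castSucc p with hj | hj
  · rw [Fin.succAbove_of_castSucc_lt _ _ hj] at hle
    exact hle.trans (hσ j.castSucc)
  have hsucc : p.succAbove j = j.succ := Fin.succAbove_of_le_castSucc _ _ hj
  have hpj : p < j.succ := hj.trans_lt Fin.castSucc_lt_succ
  rw [hsucc] at hle
  rcases (hσ j.succ).lt_or_eq with hbelow | hdiag
  · exact hle.trans (Nat.lt_succ_iff.1 hbelow)
  have hvalue : σ p < (σ ∘ p.succAbove) j := by
    rw [Function.comp_apply, hsucc, hdiag]
    exact (hσ p).trans_lt hpj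
  have hlt := std_lt_of_missing hvalue fun l => h _ hpj hdiag _ (Fin.succAbove_ne p l)
  rw [Function.comp_apply, hsucc, hdiag] at hlt
  exact Nat.lt_succ_iff.1 hlt

theorem contains_deletion {σ : Fin (N + 1) → ℕ} {f : Fin k → Fin (N + 1)} (hf : StrictMono f)
    (h : SameOrder ρ (σ ∘ f)) {p : Fin (N + 1)} (hp : p ∉ Set.range f) :
    Contains ρ (σ ∘ p.succAbove) := by
  choose g hg using fun i => Fin.exists_succAbove_eq fun hi : f i = p => hp ⟨i, hi⟩
  refine ⟨g, fun i j hij => ?_, ?_⟩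
  · rw [← (Fin.strictMono_succAbove p).lt_iff_lt, hg, hg]
    exact hf hij
  · exact fun i j => by simpa only [Function.comp_apply, hg] using h i j

-- Otherwise the standardization of `σ` without its entry at `p` would be a smaller inversion
-- sequence containing `ρ`.
theorem IsMinimalFor.repeated_and_diagonal {σ : Fin N → ℕ} (h : IsMinimalFor ρ σ)
    {f : Fin k → Fin N} (hf : StrictMono f) (hfσ : SameOrder ρ (σ ∘ f)) {p : Fin N}
    (hp : p ∉ Set.range f) : (∃ q, q ≠ p ∧ σ q = σ p) ∧ ∃ l, p < l ∧ σ l = (l : ℕ) := by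
  obtain _ | N := N
  · exact p.elim0
  by_contra hcon
  have hinv : IsInvSeq (std (σ ∘ p.succAbove)) := isInvSeq_std_deletion h.1.1
    fun l hpl hl q hqp hq => hcon ⟨⟨q, hqp, hq⟩, l, hpl, hl⟩
  have hstd := sameOrder_std (σ ∘ p.succAbove)
  have hin : InIP ρ (std (σ ∘ p.succAbove)) :=
    ⟨hinv, isCayley_std _, (contains_deletion hf hfσ hp).trans hstd.symm.contains⟩
  have hlen := (h.2 _ _ hin ⟨p.succAbove, Fin.strictMono_succAbove p, hstd⟩).length_le
  omega

end Deletion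

section Occurrences

variable {a b : ℕ}

/-- The positions which the occurrence of a pattern at the positions `f i` does not use. -/
def gaps (f : Fin a → Fin b) : Finset (Fin b) := (Finset.univ.image f)ᶜ

theorem mem_gaps {f : Fin a → Fin b} {p : Fin b} : p ∈ gaps f ↔ p ∉ Set.range f := by
  simp [gaps]

theorem card_gaps_add {f : Fin a → Fin b} (hf : f.Injective) : (gaps f).card + a = b := by
  simpa [gaps, Finset.card_image_of_injective _ hf] using
    Finset.card_compl_add_card (Finset.univ.image f)

theorem val_eq_add_card_gaps {f : Fin a → Fin b} (hf : StrictMono f) (j : Fin a) :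
    (f j : ℕ) = j + ((gaps f).filter (· < f j)).card := by
  have hsplit : Finset.Iio (f j) = (Finset.Iio j).image f ∪ (gaps f).filter (· < f j) := by
    ext p
    by_cases hp : p ∈ Set.range f
    · obtain ⟨i, rfl⟩ := hp
      simp [mem_gaps, hf.lt_iff_lt, hf.injective.eq_iff]
    · have hp' : ∀ i, f i ≠ p := fun i hi => hp ⟨i, hi⟩
      simp [mem_gaps, hp']
  have hdisj : Disjoint ((Finset.Iio j).image f) ((gaps f).filter (· < f j)) :=
    Finset.disjoint_left.2 fun p hp hp' =>
      have ⟨i, _, hi⟩ := Finset.mem_image.1 hp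
      mem_gaps.1 (Finset.mem_filter.1 hp').1 ⟨i, hi⟩
  rw [← Fin.card_Iio (f j), hsplit, Finset.card_union_of_disjoint hdisj,
    Finset.card_image_of_injective _ hf.injective, Fin.card_Iio]

theorem two_mul_card_missing_le {σ : Fin b → ℕ} (hinv : IsInvSeq σ) (hσ : IsCayley σ)
    {f : Fin a → Fin b} (hrep : ∀ p ∉ Set.range f, ∃ q, q ≠ p ∧ σ q = σ p) (s : ℕ) (l : Fin b) :
    2 * (Finset.Ico s (σ l) \ Finset.univ.image (σ ∘ f)).card ≤
      ((gaps f).filter fun p : Fin b => s ≤ (p : ℕ)).card := by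
  set E := Finset.Ico s (σ l) \ Finset.univ.image (σ ∘ f)
  have hgap : ∀ p, σ p ∈ E → p ∉ Set.range f := by
    rintro _ hp ⟨i, rfl⟩
    exact (Finset.mem_sdiff.1 hp).2 (Finset.mem_image_of_mem (σ ∘ f) (Finset.mem_univ i))
  calc 2 * E.card
    _ ≤ (Finset.univ.filter fun p => σ p ∈ E).card := by
      refine Finset.mul_card_image_le_card_of_maps_to (f := σ)
        (fun p hp => (Finset.mem_filter.1 hp).2) 2 fun v hv => ?_
      obtain ⟨p, rfl⟩ := hσ l (Finset.mem_Ico.1 (Finset.mem_sdiff.1 hv).1).2.le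
      obtain ⟨q, hqp, hq⟩ := hrep p (hgap p hv)
      exact Finset.one_lt_card.2 ⟨q, by simp [hq, hv], p, by simp [hv], hqp⟩
    _ ≤ _ := Finset.card_le_card fun p hp => by
      have hpE := (Finset.mem_filter.1 hp).2
      refine Finset.mem_filter.2 ⟨mem_gaps.2 (hgap p hpE), ?_⟩
      exact (Finset.mem_Ico.1 (Finset.mem_sdiff.1 hpE).1).1.trans (hinv p)

variable {n k : ℕ} {f : Fin k → Fin (n + k)} {σ : Fin (n + k) → ℕ}

theorem card_gaps (hf : StrictMono f) : (gaps f).card = n :=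
  Nat.add_right_cancel (card_gaps_add hf.injective)

theorem val_le_add (hf : StrictMono f) (j : Fin k) : (f j : ℕ) ≤ n + j := by
  rw [val_eq_add_card_gaps hf j, add_comm]
  exact Nat.add_le_add_right ((Finset.card_filter_le _ _).trans_eq (card_gaps hf)) _

theorem exists_mem_range_diagonal (hf : StrictMono f) (hn : n ≠ 0)
    (hdiag : ∀ p ∉ Set.range f, ∃ l, p < l ∧ σ l = (l : ℕ)) : ∃ j, σ (f j) = n + j := by
  have hne : (gaps f).Nonempty :=
    Finset.card_pos.1 ((Nat.pos_of_ne_zero hn).trans_eq (card_gaps hf).symm)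
  obtain ⟨l, hl, hdiagl⟩ := hdiag _ (mem_gaps.1 (Finset.max'_mem _ hne))
  have hbelow : ∀ p ∈ gaps f, p < l := fun p hp => (Finset.le_max' _ p hp).trans_lt hl
  obtain ⟨j, rfl⟩ : l ∈ Set.range f := by
    by_contra h
    exact lt_irrefl l (hbelow l (mem_gaps.2 h))
  refine ⟨j, ?_⟩
  rw [hdiagl, val_eq_add_card_gaps hf, Finset.filter_true_of_mem hbelow, card_gaps hf, add_comm]

variable [NeZero k]

theorem card_gaps_filter_add (hf : StrictMono f) {s : ℕ} (hs : s ≤ f 0) :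
    ((gaps f).filter fun p : Fin (n + k) => s ≤ (p : ℕ)).card + s = n := by
  have hbelow : ((gaps f).filter fun p : Fin (n + k) => ¬ s ≤ (p : ℕ)) =
      Finset.Iio ⟨s, hs.trans_lt (f 0).isLt⟩ := by
    ext p
    simp only [Finset.mem_filter, mem_gaps, Finset.mem_Iio, Fin.lt_def, not_le,
      and_iff_right_iff_imp]
    rintro hp ⟨i, rfl⟩
    exact absurd (hp.trans_le hs) (not_lt.2 (hf.monotone (Fin.zero_le i)))
  have hcard := Finset.card_filter_add_card_filter_not (s := gaps f)
    fun p : Fin (n + k) => s ≤ (p : ℕ)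
  rwa [hbelow, Fin.card_Iio, card_gaps hf] at hcard

theorem eq_natAdd_of_val_zero_eq (hf : StrictMono f) (h : (f 0 : ℕ) = n) : f = Fin.natAdd n := by
  funext j
  have hmono : ((gaps f).filter (· < f 0)).card ≤ ((gaps f).filter (· < f j)).card :=
    Finset.card_le_card (Finset.monotone_filter_right _ fun p _ hp =>
      hp.trans_le (hf.monotone (Fin.zero_le j)))
  have h0 := val_eq_add_card_gaps hf 0
  have hj := val_eq_add_card_gaps hf j
  have hle := val_le_add hf j
  simp only [Fin.ext_iff, Fin.val_natAdd]
  simp only [Fin.val_zero] at h0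
  omega

theorem start_of_repeated_and_diagonal {ρ : Fin k → ℕ} (hρ : ∀ i : Fin k, ρ i ≤ ρ 0 + i)
    (hinv : IsInvSeq σ) (hσ : IsCayley σ) (hf : StrictMono f) (hfσ : SameOrder ρ (σ ∘ f))
    (hgap : ∀ p ∉ Set.range f, (∃ q, q ≠ p ∧ σ q = σ p) ∧ ∃ l, p < l ∧ σ l = (l : ℕ)) :
    (f 0 : ℕ) = n ∧ σ (f 0) = n := by
  have hlower : n ≤ σ (f 0) := by
    rcases eq_or_ne n 0 with rfl | hn
    · exact Nat.zero_le _
    obtain ⟨j, hj⟩ := exists_mem_range_diagonal hf hn fun p hp => (hgap p hp).2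
    have hmissing := hfσ.sub_le_card_missing 0 j
    have hrepeated := two_mul_card_missing_le hinv hσ (fun p hp => (hgap p hp).1) (σ (f 0)) (f j)
    have hgaps := card_gaps_filter_add hf (hinv (f 0))
    have hρj := hρ j
    simp only [Function.comp_apply] at hmissing
    -- If `s = σ (f 0) < n`, at least `n - s` values in `[s, n + j)` are missing from the
    -- occurrence, and each of them takes up two of the `n - s` gaps from `s` on.
    omega
  have hupper : (f 0 : ℕ) ≤ n := by simpa using val_le_add hf 0
  have hdiag := hinv (f 0)
  omega

end Occurrences

section SuffixExtension

variable {n k : ℕ} [NeZero k] {ρ : Fin k → ℕ}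

/-- Inversion sequences that are Cayley permutations, consisting of a prefix of length `n` whose
values are repeated and a suffix that starts on the diagonal and is order-isomorphic to `ρ`. -/
structure IsSuffixExtension (ρ : Fin k → ℕ) (σ : Fin (n + k) → ℕ) : Prop where
  isInvSeq : IsInvSeq σ
  isCayley : IsCayley σ
  sameOrder : SameOrder ρ (σ ∘ Fin.natAdd n)
  start : σ (Fin.natAdd n 0) = n
  repeated : ∀ p : Fin (n + k), (p : ℕ) < n → ∃ q, q ≠ p ∧ σ q = σ p

theorem IsMinimalFor.isSuffixExtension (hρ : ∀ i : Fin k, ρ i ≤ ρ 0 + i) {σ : Fin (n + k) → ℕ}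
    (h : IsMinimalFor ρ σ) : IsSuffixExtension ρ σ := by
  obtain ⟨hinv, hσ, f, hf, hfσ⟩ := h.1
  have hgap := fun p hp => h.repeated_and_diagonal hf hfσ (p := p) hp
  obtain ⟨hf0, hstart⟩ := start_of_repeated_and_diagonal hρ hinv hσ hf hfσ hgap
  obtain rfl := eq_natAdd_of_val_zero_eq hf hf0
  exact ⟨hinv, hσ, hfσ, hstart, fun p hp =>
    (hgap p fun hp' => not_lt.2 ((Fin.range_natAdd n k).le hp') hp).1⟩

end SuffixExtension

section Antichain

variable {a b : ℕ} {f : Fin a → Fin b}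

theorem ne_of_card_image_add_card_gaps_le {σ : Fin b → ℕ}
    (h : (Finset.univ.image (σ ∘ f)).card + (gaps f).card ≤ (Finset.univ.image σ).card)
    {p q : Fin b} (hp : p ∉ Set.range f) (hqp : q ≠ p) : σ q ≠ σ p := fun hq => by
  have hp' := mem_gaps.2 hp
  have hcover : Finset.univ.image σ ⊆
      Finset.univ.image (σ ∘ f) ∪ ((gaps f).erase p).image σ := by
    have hcovered : ∀ r, r ≠ p →
        σ r ∈ Finset.univ.image (σ ∘ f) ∪ ((gaps f).erase p).image σ := fun r hr => by
      by_cases hrange : r ∈ Set.range f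
      · obtain ⟨i, rfl⟩ := hrange
        exact Finset.mem_union_left _ (Finset.mem_image_of_mem (σ ∘ f) (Finset.mem_univ i))
      · exact Finset.mem_union_right _
          (Finset.mem_image_of_mem σ (Finset.mem_erase.2 ⟨hr, mem_gaps.2 hrange⟩))
    refine Finset.image_subset_iff.2 fun r _ => ?_
    rcases eq_or_ne r p with rfl | hr
    · exact hq ▸ hcovered q hqp
    · exact hcovered r hr
  have hcard := ((Finset.card_le_card hcover).trans (Finset.card_union_le _ _)).trans
    (Nat.add_le_add_left Finset.card_image_le _)
  have hpos := Finset.card_pos.2 ⟨p, hp'⟩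
  rw [Finset.card_erase_of_mem hp'] at hcard
  omega

/-- The positions of the values of `σ` that are at least `t` and occur more than once. -/
def repeatedPositions (σ : Fin a → ℕ) (t : ℕ) : Finset (Fin a) :=
  Finset.univ.filter fun p => t ≤ σ p ∧ ∃ q, q ≠ p ∧ σ q = σ p

theorem mem_repeatedPositions {σ : Fin a → ℕ} {t : ℕ} {p : Fin a} :
    p ∈ repeatedPositions σ t ↔ t ≤ σ p ∧ ∃ q, q ≠ p ∧ σ q = σ p := by
  simp [repeatedPositions]

theorem SameOrder.card_repeatedPositions {α : Fin a → ℕ} {β : Fin b → ℕ}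
    (h : SameOrder α (β ∘ f)) (hf : f.Injective) (j : Fin a)
    (hrange : ∀ p ∈ repeatedPositions β (β (f j)), p ∈ Set.range f) :
    (repeatedPositions α (α j)).card = (repeatedPositions β (β (f j))).card := by
  have himage : (repeatedPositions α (α j)).image f = repeatedPositions β (β (f j)) := by
    ext p
    rw [Finset.mem_image]
    constructor
    · rintro ⟨i, hi, rfl⟩
      obtain ⟨hji, l, hli, hl⟩ := mem_repeatedPositions.1 hi
      exact mem_repeatedPositions.2
        ⟨(h.le_iff j i).1 hji, f l, hf.ne hli, (h.eq_iff l i).1 hl⟩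
    · intro hp
      obtain ⟨i, rfl⟩ := hrange p hp
      obtain ⟨hji, q, hqp, hq⟩ := mem_repeatedPositions.1 hp
      obtain ⟨l, rfl⟩ := hrange q (mem_repeatedPositions.2 ⟨hq ▸ hji, f i, hqp.symm, hq.symm⟩)
      exact ⟨i, mem_repeatedPositions.2
        ⟨(h.le_iff j i).2 hji, l, fun hl => hqp (hl ▸ rfl), (h.eq_iff l i).2 hq⟩, rfl⟩
  rw [← himage, Finset.card_image_of_injective _ hf]

variable {n k : ℕ} [NeZero k] {ρ : Fin k → ℕ}

namespace IsSuffixExtension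

variable {σ : Fin (n + k) → ℕ}

theorem mem_range_natAdd_of_le (h : IsSuffixExtension ρ σ) {p : Fin (n + k)} (hp : n ≤ σ p) :
    p ∈ Set.range (Fin.natAdd n : Fin k → Fin (n + k)) :=
  (Fin.range_natAdd n k).ge (hp.trans (h.isInvSeq p))

theorem card_repeatedPositions (h : IsSuffixExtension ρ σ) :
    (repeatedPositions ρ (ρ 0)).card = (repeatedPositions σ n).card := by
  have hcard := h.sameOrder.card_repeatedPositions (Fin.natAdd_injective k n) 0 fun p hp =>
    h.mem_range_natAdd_of_le (h.start.symm.trans_le (mem_repeatedPositions.1 hp).1)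
  rwa [h.start] at hcard

theorem card_image (h : IsSuffixExtension ρ σ) :
    (Finset.univ.image σ).card = n + ((Finset.univ.filter fun i => ρ 0 ≤ ρ i).image ρ).card := by
  have hstart : (σ ∘ Fin.natAdd n) 0 = n := h.start
  have hsplit : Finset.univ.image σ = Finset.range n ∪
      (Finset.univ.filter fun i => n ≤ (σ ∘ Fin.natAdd n) i).image (σ ∘ Fin.natAdd n) := by
    ext v
    simp only [Finset.mem_union, Finset.mem_image, Finset.mem_filter, Finset.mem_univ, true_and,
      Finset.mem_range]
    constructor
    · rintro ⟨p, rfl⟩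
      refine (lt_or_ge (σ p) n).imp_right fun hp => ?_
      obtain ⟨i, rfl⟩ := h.mem_range_natAdd_of_le hp
      exact ⟨i, hp, rfl⟩
    · rintro (hv | ⟨i, -, rfl⟩)
      · exact h.isCayley (Fin.natAdd n 0) (hv.le.trans_eq h.start.symm)
      · exact ⟨_, rfl⟩
  have hdisj : Disjoint (Finset.range n)
      ((Finset.univ.filter fun i => n ≤ (σ ∘ Fin.natAdd n) i).image (σ ∘ Fin.natAdd n)) :=
    Finset.disjoint_right.2 <| Finset.forall_mem_image.2 fun i hi => by
      simpa using (Finset.mem_filter.1 hi).2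
  rw [hsplit, Finset.card_union_of_disjoint hdisj, Finset.card_range, h.sameOrder.card_image]
  simp only [h.sameOrder.le_iff, hstart]

variable {n' : ℕ} {τ : Fin (n' + k) → ℕ}

theorem mem_range_of_repeated (hσ : IsSuffixExtension ρ σ) (hτ : IsSuffixExtension ρ τ)
    {f : Fin (n' + k) → Fin (n + k)} (hf : StrictMono f) (hτσ : SameOrder τ (σ ∘ f))
    {p q : Fin (n + k)} (hqp : q ≠ p) (hq : σ q = σ p) : p ∈ Set.range f := by
  by_contra hp
  refine ne_of_card_image_add_card_gaps_le ?_ hp hqp hq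
  have hgaps := card_gaps_add hf.injective
  rw [← hτσ.card_image, hτ.card_image, hσ.card_image]
  omega

theorem not_contains (hσ : IsSuffixExtension ρ σ) (hτ : IsSuffixExtension ρ τ) (hn : n' < n) :
    ¬ Contains τ σ := by
  -- Only unique values of `σ` can be left out, so `f` fixes `n'`, the start of the occurrence in
  -- `τ`. But `σ n' < n` is repeated, so more repeated positions lie above `σ n'` than above `n`,
  -- whereas for both `τ` above `n'` and `σ` above `n` their number is that of `ρ` above `ρ 0`.
  rintro ⟨f, hf, hτσ⟩
  have hrange : ∀ p q, q ≠ p → σ q = σ p → p ∈ Set.range f := fun p q =>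
    hσ.mem_range_of_repeated hτ hf hτσ
  have hinitial : ∀ p : Fin (n + k), (p : ℕ) < n → p ∈ Set.range f := fun p hp =>
    have ⟨q, hqp, hq⟩ := hσ.repeated p hp
    hrange p q hqp hq
  have hfixed : (f (Fin.natAdd n' 0) : ℕ) = n' := by
    obtain ⟨y, hy⟩ := hinitial ⟨n', hn.trans_le (Nat.le_add_right n k)⟩ hn
    have hempty : (gaps f).filter (· < f y) = ∅ := Finset.filter_eq_empty_iff.2 fun p hp hpy =>
      mem_gaps.1 hp (hinitial p ((Fin.lt_def.1 (hy ▸ hpy)).trans hn))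
    have hyn := val_eq_add_card_gaps hf y
    rw [hempty, Finset.card_empty, hy] at hyn
    obtain rfl : y = Fin.natAdd n' 0 := Fin.ext (by simpa using hyn.symm)
    exact congrArg Fin.val hy
  set x := f (Fin.natAdd n' 0)
  have hx : σ x < n := (hσ.isInvSeq x).trans_lt (hfixed.trans_lt hn)
  have hcard : (repeatedPositions τ (τ (Fin.natAdd n' 0))).card =
      (repeatedPositions σ (σ x)).card :=
    SameOrder.card_repeatedPositions hτσ hf.injective _ fun p hp =>
      have ⟨_, q, hqp, hq⟩ := mem_repeatedPositions.1 hp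
      hrange p q hqp hq
  have hlt : (repeatedPositions σ n).card < (repeatedPositions σ (σ x)).card := by
    refine Finset.card_lt_card (Finset.ssubset_iff_of_subset (fun p hp => ?_) |>.2 ⟨x, ?_, ?_⟩)
    · have ⟨hnp, hrep⟩ := mem_repeatedPositions.1 hp
      exact mem_repeatedPositions.2 ⟨hx.le.trans hnp, hrep⟩
    · exact mem_repeatedPositions.2 ⟨le_rfl, hσ.repeated x (hfixed.trans_lt hn)⟩
    · exact fun hmem => not_lt.2 (mem_repeatedPositions.1 hmem).1 hx
  rw [← hcard, hτ.start, ← hτ.card_repeatedPositions, hσ.card_repeatedPositions] at hlt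
  exact lt_irrefl _ hlt

end IsSuffixExtension

theorem isMinimalFor_iff (hρ : ∀ i : Fin k, ρ i ≤ ρ 0 + i) {σ : Fin (n + k) → ℕ} :
    IsMinimalFor ρ σ ↔ IsSuffixExtension ρ σ := by
  refine ⟨fun h => h.isSuffixExtension hρ, fun h => ⟨⟨h.isInvSeq, h.isCayley,
    Fin.natAdd n, Fin.strictMono_natAdd n, h.sameOrder⟩, fun l τ hτ hτσ => ?_⟩⟩
  obtain ⟨l', τ', hmin, hτ'τ⟩ := hτ.exists_isMinimalFor
  have hτ'σ := hτ'τ.trans hτσ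
  obtain ⟨n', rfl⟩ := Nat.exists_eq_add_of_le' hmin.1.2.2.length_le
  rcases lt_or_ge n' n with hlt | hge
  · exact absurd hτ'σ (h.not_contains (hmin.isSuffixExtension hρ) hlt)
  obtain rfl : n' = n := (Nat.le_of_add_le_add_right hτ'σ.length_le).antisymm hge
  exact hτ'σ.sameOrder.symm.contains.trans hτ'τ

end Antichain

section Extension

namespace ColouredInvSeq

variable {n k : ℕ} (s : ColouredInvSeq n)

/-- The values that the suffix of an extension of `s` may take: the blue ones, and all from `n`
on. -/
def Available (v : ℕ) : Prop := ∀ h : v < n, s.colour ⟨v, h⟩ = Colour.blue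

instance : DecidablePred s.Available := fun v =>
  inferInstanceAs (Decidable (∀ h : v < n, s.colour ⟨v, h⟩ = Colour.blue))

theorem available_of_le {v : ℕ} (hv : n ≤ v) : s.Available v := fun h => absurd h (not_lt.2 hv)

theorem infinite_available : (Set.ofPred s.Available).Infinite :=
  (Set.Ici_infinite n).mono fun _ => s.available_of_le

theorem count_available (d : ℕ) :
    Nat.count s.Available (n + d) = {v | s.colour v = Colour.blue}.ncard + d := by
  have hinitial : Nat.count s.Available n = {v | s.colour v = Colour.blue}.ncard := by
    rw [Nat.count_eq_card_filter_range, ← Set.ncard_coe_finset,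
      ← Set.ncard_image_of_injective _ Fin.val_injective]
    congr 1
    ext v
    simp only [Finset.coe_filter, Finset.mem_range, Set.mem_ofPred_eq, Set.mem_image]
    exact ⟨fun ⟨hv, h⟩ => ⟨⟨v, hv⟩, h hv, rfl⟩, fun ⟨i, hi, hiv⟩ => hiv ▸ ⟨i.isLt, fun _ => hi⟩⟩
  rw [Nat.count_add, hinitial, Nat.count_of_forall]
  exact fun _ _ => s.available_of_le (Nat.le_add_right _ _)

/-- The inversion sequence with prefix `s` whose suffix is order-isomorphic to `ρ` and has the
available values. -/
noncomputable def extend (ρ : Fin k → ℕ) : Fin (n + k) → ℕ :=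
  Fin.append s.val fun i => Nat.nth s.Available (ρ i)

variable (ρ : Fin k → ℕ)

theorem extend_castAdd (i : Fin n) : s.extend ρ (Fin.castAdd k i) = s.val i :=
  Fin.append_left _ _ _

theorem extend_natAdd (i : Fin k) : s.extend ρ (Fin.natAdd n i) = Nat.nth s.Available (ρ i) :=
  Fin.append_right _ _ _

variable {s ρ}

theorem exists_extend_natAdd_eq_iff (hρ : IsCayley ρ) (i : Fin k) {v : ℕ}
    (hv : v ≤ s.extend ρ (Fin.natAdd n i)) :
    (∃ j, s.extend ρ (Fin.natAdd n j) = v) ↔ s.Available v := by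
  simp only [extend_natAdd] at hv ⊢
  constructor
  · rintro ⟨j, rfl⟩
    exact Nat.nth_mem_of_infinite s.infinite_available _
  · intro havail
    obtain ⟨j, hj⟩ := hρ i ((Nat.count_le_iff_le_nth s.infinite_available).2 hv)
    exact ⟨j, by rw [hj, Nat.nth_count havail]⟩

theorem isInvSeq_extend (h : ∀ i : Fin k, ρ i ≤ {v | s.colour v = Colour.blue}.ncard + i) :
    IsInvSeq (s.extend ρ) := fun p => by
  induction p using Fin.addCases with
  | left i =>
    rw [extend_castAdd]
    exact s.isInvSeq i
  | right i =>
    rw [extend_natAdd, Fin.val_natAdd, ← Nat.lt_succ_iff]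
    refine Nat.nth_lt_of_lt_count ?_
    rw [Nat.succ_eq_add_one, add_assoc, count_available, ← add_assoc]
    exact Nat.lt_succ_of_le (h i)

variable [NeZero k]

theorem extend_natAdd_zero (hs : s ∈ setA n (ρ 0)) : s.extend ρ (Fin.natAdd n 0) = n := by
  have hcount : Nat.count s.Available n = ρ 0 := (s.count_available 0).trans hs.1
  rw [extend_natAdd, ← hcount, Nat.nth_count (s.available_of_le le_rfl)]

theorem colour_eq_blue_iff (hρ : IsCayley ρ) (hs : s ∈ setA n (ρ 0)) (v : Fin n) :
    s.colour v = Colour.blue ↔ ∃ j, s.extend ρ (Fin.natAdd n j) = v := by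
  rw [exists_extend_natAdd_eq_iff hρ 0 (v.isLt.le.trans_eq (extend_natAdd_zero hs).symm)]
  exact ⟨fun h _ => h, fun h => h v.isLt⟩

theorem isCayley_extend (hρ : IsCayley ρ) (hs : s ∈ setA n (ρ 0)) : IsCayley (s.extend ρ) := by
  have hsuffix : ∀ i, Set.Iic (s.extend ρ (Fin.natAdd n i)) ⊆ Set.range (s.extend ρ) := by
    intro i v hv
    by_cases havail : s.Available v
    · obtain ⟨j, hj⟩ := (exists_extend_natAdd_eq_iff hρ i hv).2 havail
      exact ⟨_, hj⟩
    obtain ⟨hvn, hred⟩ := not_forall.1 havail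
    have htwo := hs.2.2 ⟨v, hvn⟩ (Colour.eq_red_iff.2 hred)
    obtain ⟨j, hj⟩ := Set.nonempty_of_ncard_ne_zero (two_pos.trans_le htwo).ne'
    exact ⟨Fin.castAdd k j, (s.extend_castAdd ρ j).trans hj⟩
  intro p
  induction p using Fin.addCases with
  | right i => exact hsuffix i
  | left i =>
    refine (Set.Iic_subset_Iic.2 ?_).trans (hsuffix 0)
    rw [extend_castAdd, extend_natAdd_zero hs]
    exact (s.isInvSeq i).trans i.isLt.le

theorem exists_ne_extend_eq (hρ : IsCayley ρ) (hs : s ∈ setA n (ρ 0)) (i : Fin n) :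
    ∃ q, q ≠ Fin.castAdd k i ∧ s.extend ρ q = s.val i := by
  have hval : s.val i < n := (s.isInvSeq i).trans_lt i.isLt
  by_cases hblue : s.colour ⟨s.val i, hval⟩ = Colour.blue
  · obtain ⟨j, hj⟩ := (colour_eq_blue_iff hρ hs _).1 hblue
    exact ⟨_, fun h => by simpa using (congrArg Fin.val h).trans_lt i.isLt, hj⟩
  · have htwo := hs.2.2 _ (Colour.eq_red_iff.2 hblue)
    obtain ⟨j, hj, hji⟩ := Set.exists_ne_of_one_lt_ncard htwo i
    exact ⟨Fin.castAdd k j, (Fin.castAdd_injective n k).ne hji, (s.extend_castAdd ρ j).trans hj⟩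

theorem isSuffixExtension_extend (hρ : IsCayley ρ) (hm : ∀ i : Fin k, ρ i ≤ ρ 0 + i)
    (hs : s ∈ setA n (ρ 0)) : IsSuffixExtension ρ (s.extend ρ) where
  isInvSeq := isInvSeq_extend (by rwa [hs.1])
  isCayley := isCayley_extend hρ hs
  sameOrder i j := by
    simp only [Function.comp_apply, extend_natAdd, Nat.nth_lt_nth s.infinite_available]
  start := extend_natAdd_zero hs
  repeated p hp := by
    obtain ⟨q, hqp, hq⟩ := exists_ne_extend_eq hρ hs ⟨p, hp⟩
    exact ⟨q, hqp, hq.trans (s.extend_castAdd ρ ⟨p, hp⟩).symm⟩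

theorem injOn_extend (hρ : IsCayley ρ) :
    Set.InjOn (fun s : ColouredInvSeq n => s.extend ρ) (setA n (ρ 0)) := by
  intro s hs t ht (h : s.extend ρ = t.extend ρ)
  refine ColouredInvSeq.ext (funext fun i => ?_) (funext fun v => ?_)
  · rw [← s.extend_castAdd ρ, h, t.extend_castAdd]
  · have hblue := (colour_eq_blue_iff hρ hs v).trans (h ▸ (colour_eq_blue_iff hρ ht v).symm)
    by_cases hb : s.colour v = Colour.blue
    · rw [hb, hblue.1 hb]
    · rw [Colour.eq_red_iff.2 hb, Colour.eq_red_iff.2 (hblue.not.1 hb)]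

end ColouredInvSeq

/-- The prefix of length `n` of `σ`, with those values coloured blue that occur in the rest of `σ`:
the inverse of `ColouredInvSeq.extend`. -/
def prefixColouring {n k : ℕ} (σ : Fin (n + k) → ℕ) (hσ : IsInvSeq σ) : ColouredInvSeq n where
  val i := σ (Fin.castAdd k i)
  isInvSeq i := hσ (Fin.castAdd k i)
  colour v := if ∃ j, σ (Fin.natAdd n j) = (v : ℕ) then Colour.blue else Colour.red

theorem prefixColouring_colour_eq_blue_iff {n k : ℕ} {σ : Fin (n + k) → ℕ} (hσ : IsInvSeq σ)
    (v : Fin n) : (prefixColouring σ hσ).colour v = Colour.blue ↔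
      ∃ j, σ (Fin.natAdd n j) = (v : ℕ) := by
  simp [prefixColouring]

namespace IsSuffixExtension

variable {n k : ℕ} [NeZero k] {ρ : Fin k → ℕ} {σ : Fin (n + k) → ℕ}

theorem available_prefixColouring_iff (h : IsSuffixExtension ρ σ) (i : Fin k) {v : ℕ}
    (hv : v ≤ σ (Fin.natAdd n i)) :
    (prefixColouring σ h.isInvSeq).Available v ↔ ∃ j, σ (Fin.natAdd n j) = v := by
  rcases lt_or_ge v n with hvn | hvn
  · rw [← prefixColouring_colour_eq_blue_iff h.isInvSeq ⟨v, hvn⟩]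
    exact ⟨fun havail => havail hvn, fun hblue _ => hblue⟩
  · refine iff_of_true (ColouredInvSeq.available_of_le _ hvn) ?_
    obtain ⟨p, rfl⟩ := h.isCayley _ hv
    obtain ⟨j, rfl⟩ := h.mem_range_natAdd_of_le hvn
    exact ⟨j, rfl⟩

theorem count_available_prefixColouring (h : IsSuffixExtension ρ σ) (hρ : IsCayley ρ)
    (i : Fin k) :
    Nat.count (prefixColouring σ h.isInvSeq).Available (σ (Fin.natAdd n i)) = ρ i := by
  refine Eq.trans ?_ (congrFun (std_eq_of_sameOrder hρ h.sameOrder) i)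
  exact (Nat.count_mono_left fun v hv => (h.available_prefixColouring_iff i hv.le).1).antisymm
    (Nat.count_mono_left fun v hv => (h.available_prefixColouring_iff i hv.le).2)

theorem extend_prefixColouring (h : IsSuffixExtension ρ σ) (hρ : IsCayley ρ) :
    (prefixColouring σ h.isInvSeq).extend ρ = σ := funext fun p => by
  induction p using Fin.addCases with
  | left i => exact ColouredInvSeq.extend_castAdd _ ρ i
  | right i =>
    rw [ColouredInvSeq.extend_natAdd, ← h.count_available_prefixColouring hρ i]
    exact Nat.nth_count ((h.available_prefixColouring_iff i le_rfl).2 ⟨i, rfl⟩)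

theorem prefixColouring_mem_setA (h : IsSuffixExtension ρ σ) (hρ : IsCayley ρ) :
    prefixColouring σ h.isInvSeq ∈ setA n (ρ 0) := by
  refine mem_setA_iff.2 ⟨?_, fun v hv => ?_⟩
  · have hcount := h.count_available_prefixColouring hρ 0
    rw [h.start] at hcount
    exact ((prefixColouring σ h.isInvSeq).count_available 0).symm.trans hcount
  have hinitial : ∀ p, σ p = v → ∃ i : Fin n, Fin.castAdd k i = p := fun p hp => by
    induction p using Fin.addCases with
    | left i => exact ⟨i, rfl⟩
    | right j =>
      rw [Colour.eq_red_iff, Ne, prefixColouring_colour_eq_blue_iff] at hv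
      exact absurd ⟨j, hp⟩ hv
  obtain ⟨p, hp⟩ := h.isCayley (Fin.natAdd n 0) (v.isLt.le.trans_eq h.start.symm)
  obtain ⟨i, rfl⟩ := hinitial p hp
  obtain ⟨q, hqi, hq⟩ := h.repeated (Fin.castAdd k i) i.isLt
  obtain ⟨j, rfl⟩ := hinitial q (hq.trans hp)
  exact (Set.one_lt_ncard (Set.toFinite _)).2
    ⟨i, hp, j, hq.trans hp, fun hij => hqi (congrArg _ hij.symm)⟩

end IsSuffixExtension

theorem bijOn_extend {k : ℕ} [NeZero k] {ρ : Fin k → ℕ} (hρ : IsCayley ρ)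
    (hm : ∀ i : Fin k, ρ i ≤ ρ 0 + i) (n : ℕ) :
    Set.BijOn (fun s : ColouredInvSeq n => s.extend ρ) (setA n (ρ 0)) {σ | IsMinimalFor ρ σ} :=
  ⟨fun _ hs => (isMinimalFor_iff hm).2 (ColouredInvSeq.isSuffixExtension_extend hρ hm hs),
    ColouredInvSeq.injOn_extend hρ, fun _ hσ =>
      have h := (isMinimalFor_iff hm).1 hσ
      ⟨_, h.prefixColouring_mem_setA hρ, h.extend_prefixColouring hρ⟩⟩

end Extension

section Counting

theorem le_of_mem_setA {n m : ℕ} {s : ColouredInvSeq n} (hs : s ∈ setA n m) : m ≤ n := by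
  rw [← hs.1]
  simpa using Set.ncard_le_card {v | s.colour v = Colour.blue}

theorem le_two_mul_of_mem_setA {n m : ℕ} {s : ColouredInvSeq n} (hs : s ∈ setA n m) :
    n ≤ 2 * m := by
  have hval : ∀ i, s.val i < n := fun i => (s.isInvSeq i).trans_lt i.isLt
  have hred : (Finset.univ.filter fun v => s.colour v = Colour.red).card = n - m := by
    rw [← hs.2.1, ← Set.ncard_coe_finset]
    simp
  have hfibres := Finset.mul_card_image_le_card_of_maps_to
    (s := Finset.univ.filter fun i => s.colour ⟨s.val i, hval i⟩ = Colour.red)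
    (t := Finset.univ.filter fun v => s.colour v = Colour.red)
    (f := fun i => ⟨s.val i, hval i⟩) (fun i hi => by simpa using hi) 2 fun v hv => by
      have hv := (Finset.mem_filter.1 hv).2
      refine (hs.2.2 v hv).trans_eq ?_
      rw [← Set.ncard_coe_finset]
      congr 1
      ext i
      simp only [Set.mem_ofPred_eq, Finset.coe_filter, Finset.mem_filter_univ, Fin.ext_iff]
      exact ⟨fun h => ⟨by simpa only [h] using hv, h⟩, And.right⟩
  have hle := hfibres.trans (Finset.card_filter_le _ _)
  rw [hred, Finset.card_univ, Fintype.card_fin] at hle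
  have := le_of_mem_setA hs
  omega

theorem finite_isMinimalFor {k n : ℕ} (ρ : Fin k → ℕ) :
    {σ : Fin n → ℕ | IsMinimalFor ρ σ}.Finite :=
  (Set.Finite.pi' fun i : Fin n => Set.finite_Iic (i : ℕ)).subset fun _ hσ i => hσ.1.1 i

theorem sub_le_mdd {n : ℕ} [NeZero n] (σ : Fin n → ℕ) (i : Fin n) :
    (σ i : ℤ) - (i : ℕ) ≤ mdd σ :=
  Finset.le_sup' (fun i : Fin n => (σ i : ℤ) - ((i : ℕ) : ℤ)) (Finset.mem_univ i)

variable {k : ℕ} [NeZero k] {ρ : Fin k → ℕ}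

theorem ncard_isMinimalFor (hρ : IsCayley ρ) (hm : ∀ i : Fin k, ρ i ≤ ρ 0 + i) (n : ℕ) :
    {σ : Fin (n + k) → ℕ | IsMinimalFor ρ σ}.ncard = (setA n (ρ 0)).ncard :=
  (bijOn_extend hρ hm n).ncard_eq.symm

theorem IsMinimalFor.exists_length_eq {N : ℕ} {σ : Fin N → ℕ} (h : IsMinimalFor ρ σ)
    (hρ : IsCayley ρ) (hm : ∀ i : Fin k, ρ i ≤ ρ 0 + i) :
    ∃ n ∈ Finset.Icc (ρ 0) (2 * ρ 0), n + k = N := by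
  obtain ⟨n, rfl⟩ := Nat.exists_eq_add_of_le' h.1.2.2.length_le
  obtain ⟨s, hs, -⟩ := (bijOn_extend hρ hm n).surjOn h
  exact ⟨n, Finset.mem_Icc.2 ⟨le_of_mem_setA hs, le_two_mul_of_mem_setA hs⟩, rfl⟩

theorem finite_and_ncard_sigma_isMinimalFor (hρ : IsCayley ρ)
    (hm : ∀ i : Fin k, ρ i ≤ ρ 0 + i) :
    {σ : (N : ℕ) × (Fin N → ℕ) | IsMinimalFor ρ σ.2}.Finite ∧
      {σ : (N : ℕ) × (Fin N → ℕ) | IsMinimalFor ρ σ.2}.ncard =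
        ∑ n ∈ Finset.Icc (ρ 0) (2 * ρ 0), (setA n (ρ 0)).ncard := by
  have hsigma : {σ : (N : ℕ) × (Fin N → ℕ) | IsMinimalFor ρ σ.2} =
      ((Finset.Icc (ρ 0) (2 * ρ 0)).map (addRightEmbedding k)).sigma
        fun N => (finite_isMinimalFor (n := N) ρ).toFinset := by
    ext ⟨N, σ⟩
    simp only [Finset.coe_sigma, Set.Finite.coe_toFinset, Set.mem_sigma_iff, Set.mem_ofPred_eq,
      Finset.mem_coe, Finset.mem_map, addRightEmbedding_apply]
    exact ⟨fun h => ⟨h.exists_length_eq hρ hm, h⟩, And.right⟩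
  rw [hsigma, Set.ncard_coe_finset, Finset.card_sigma, Finset.sum_map]
  refine ⟨Finset.finite_toSet _, Finset.sum_congr rfl fun n _ => ?_⟩
  exact (Set.ncard_eq_toFinset_card _ (finite_isMinimalFor ρ)).symm.trans
    (ncard_isMinimalFor hρ hm n)

end Counting

end InvSeq

theorem mainTheorem9 :
    -- the differential equation and the initial condition; `PowerSeries.C PowerSeries.X` is `y`
    (PowerSeries.derivative ℚ⟦X⟧ InvSeq.genB =
        (PowerSeries.C PowerSeries.X + 1) *
          (PowerSeries.exp ℚ⟦X⟧).subst InvSeq.genB - InvSeq.genB - 1 ∧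
      PowerSeries.constantCoeff InvSeq.genB = 0) ∧
    -- the bijection between `A_{n,m}` and `B_{n+1,m+1}`
    (∀ n m : ℕ,
      Set.BijOn InvSeq.phi (InvSeq.setA n m) (InvSeq.setB (n + 1) (m + 1))) ∧
    -- the enumeration of minimal inversion sequences, by length and in total
    (∀ (k : ℕ) [NeZero k] (m : ℕ) (ρ : Fin k → ℕ), InvSeq.IsCayley ρ →
      (ρ 0 : ℤ) = InvSeq.mdd ρ → InvSeq.mdd ρ = (m : ℤ) →
      (∀ n : ℕ,
        {σ : Fin (n + k) → ℕ | InvSeq.IsMinimalFor ρ σ}.ncard = (InvSeq.setA n m).ncard ∧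
        {σ : Fin (n + k) → ℕ | InvSeq.IsMinimalFor ρ σ}.ncard =
          (InvSeq.setB (n + 1) (m + 1)).ncard ∧
        ({σ : Fin (n + k) → ℕ | InvSeq.IsMinimalFor ρ σ}.ncard : ℚ) =
          ((n + 1)! : ℚ) *
            PowerSeries.coeff (m + 1) (PowerSeries.coeff (n + 1) InvSeq.genB)) ∧
      {σ : (N : ℕ) × (Fin N → ℕ) | InvSeq.IsMinimalFor ρ σ.2}.Finite ∧
      {σ : (N : ℕ) × (Fin N → ℕ) | InvSeq.IsMinimalFor ρ σ.2}.ncard =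
        ∑ n ∈ Finset.Icc m (2 * m), (InvSeq.setA n m).ncard) := by
  refine ⟨InvSeq.genB_differential_equation, InvSeq.bijOn_phi, fun k _ m ρ hρ hstart hmdd => ?_⟩
  obtain rfl : ρ 0 = m := by exact_mod_cast hstart.trans hmdd
  have hm : ∀ i : Fin k, ρ i ≤ ρ 0 + i := fun i => by
    have := (InvSeq.sub_le_mdd ρ i).trans_eq hmdd
    omega
  refine ⟨fun n => ?_, InvSeq.finite_and_ncard_sigma_isMinimalFor hρ hm⟩
  have hcard := InvSeq.ncard_isMinimalFor hρ hm n
  refine ⟨hcard, hcard.trans (InvSeq.ncard_setA_eq_ncard_setB n _), ?_⟩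
  rw [InvSeq.coeff_coeff_genB, hcard, InvSeq.ncard_setA_eq_ncard_setB]
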